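/- Let $G\subset \mathrm{GL}_N(\mathbb{C})$ be a connected reductive linear algebraic group with Lie algebra $\mathfrak{g}$, let $k\ge 0$, and let $$H\,dz=\Bigl(\frac{H_k}{z^k}+\cdots+\frac{H_1}{z}+H_{\mathrm{res}}\Bigr)\frac{dz}{z}$$ be an unramified canonical form: $H_i,H_{\mathrm{res}}\in\mathfrak{g}$ commute pairwise and $H_1,\dots,H_k$ are semisimple. Let $H_{\mathrm{res}}=H_0+J_0$ be the Jordan decomposition ($H_0$ semisimple, $J_0$ nilpotent). Fix a Cartan subalgebra (maximal toral subalgebra) $\mathfrak{t}\subset\mathfrak{g}$ containing $H_0,\dots,H_k$, with root set $\Phi$, and a system $\Pi\subset\Phi$ of simple roots. Put $$\Pi_i:=\{\alpha\in\Pi\mid \alpha(H_k)=\cdots=\alpha(H_i)=0\}\quad(0\le i\le k),\qquad \Pi_{k+1}:=\Pi .$$ Assume, as the Weyl group allows, that $H$ is normalized: for $i=k,k-1,\dots,0$ and all $\alpha\in\Pi_{i+1}$ one has $\mathrm{Re}\,\alpha(H_i)\ge 0$, and $\mathrm{Im}\,\alpha(H_i)\ge 0$ if $\mathrm{Re}\,\alpha(H_i)=0$.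 For a sequence $P_m\supset\cdots\supset P_0$ of subsets of $\Pi$ (with $P_{m+1}:=\Pi$) and a nilpotent $J$, write $(P_m\supset\cdots\supset P_0;[J])$ for the pair of the sequence and the orbit $[J]$ of $J$ under the adjoint action of the Levi subgroup $L_1\subset G$ that belongs to $P_1$, i.e. the analytic subgroup with Lie algebra $\mathfrak{t}\oplus\bigoplus_{\alpha\in\Phi\cap\mathbb{Z}P_1}\mathfrak{g}_\alpha$. The spectral type of $H$ with respect to $(\mathfrak{t},\Pi)$ is $(\Pi_k\supset\cdots\supset\Pi_0;[J_0])$. The spectral type with respect to $(\mathfrak{t},\Pi)$ of any canonical form $\sum_{\nu=0}^{m}A_\nu(z-a)^{-\nu-1}dz$ at a point $a$ is given in the same way by the sets $\{\alpha\in\Pi\mid\alpha((A_\mu)_{\mathrm{ss}})=0\text{ for all }\mu\ge\nu\}$, $0\le \nu\le m$, and the nilpotent part of $A_0$, whenever the semisimple parts $(A_\mu)_{\mathrm{ss}}$ lie in $\mathfrak{t}$. For $\alpha\in\Pi\setminus\Pi_0$ let $d(\alpha):=\max\{i\in\{0,\dots,k\}\mid\alpha\notin\Pi_i\}$ and $$f_\alpha^{(i)}(x_0,\dots,x_k):=\sum_{j=i}^{d(\alpha)}\alpha(H_j)\prod_{\nu=j+1}^{d(\alpha)}(x_i-x_\nu)\qquad(0\le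 i\le d(\alpha)),$$ and let $\mathbb{B}_H\subset\mathbb{C}^{k+1}$ be the set of all $\mathbf{c}$ with $f_\alpha^{(i)}(\mathbf{c})\ne 0$ for all $\alpha\in\Pi\setminus\Pi_0$ and $0\le i\le d(\alpha)$. The unfolding of $H$ is $$H(\mathbf{c}):=\frac{H_{\mathrm{res}}}{z-c_0}+\sum_{i=1}^{k}\frac{H_i}{(z-c_0)(z-c_1)\cdots(z-c_i)}\in\mathfrak{g}\otimes\mathbb{C}(z).$$ Let $I_0\sqcup\cdots\sqcup I_r=\{0,1,\dots,k\}$ be a partition $\mathcal{I}$ into nonempty sets with $0\in I_0$, write $I_j=\{i_{[j,0]}<\cdots<i_{[j,k_j]}\}$, and let $C(\mathcal{I})\subset\mathbb{C}^{k+1}$ be the stratum of all $\mathbf{c}$ such that $c_i=c_{i'}$ if and only if $i$ and $i'$ lie in the same part. Suppose $\mathbf{c}\in\mathbb{B}_H\cap C(\mathcal{I})$. Then $H(\mathbf{c})$ has a unique partial fraction decomposition $$H(\mathbf{c})=\sum_{j=0}^{r}H(\mathbf{c})_j,\qquad H(\mathbf{c})_j=\sum_{\nu=0}^{k_j}\frac{A^{[j]}_\nu}{(z-c_{i_{[j,0]}})^{\nu+1}},\quad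 A^{[j]}_\nu\in\mathfrak{g};$$ each $H(\mathbf{c})_j$ is a canonical form at $z=c_{i_{[j,0]}}$, the semisimple parts of whose coefficients lie in $\mathfrak{t}$; and its spectral type with respect to $(\mathfrak{t},\Pi)$ is $$(\Pi_{i_{[0,k_0]}}\supset\cdots\supset\Pi_{i_{[0,0]}};[J_0])\ \text{ for } j=0,\qquad (\Pi_{i_{[j,k_j]}}\supset\cdots\supset\Pi_{i_{[j,0]}};[0])\ \text{ for } 1\le j\le r .$$ -/

import Mathlib

open scoped TensorProduct

attribute [local instance 100] LieRing.ofAssociativeRing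

noncomputable section

namespace Unfolding

/-- `N × N` complex matrices. -/
abbrev Mat (N : ℕ) : Type := Matrix (Fin N) (Fin N) ℂ

variable {N : ℕ}

/-! ### Linear algebraic groups over `ℂ`, embedded in `GL N` -/

/-- Value at the matrix `A` of a polynomial in the `N * N` matrix entries. -/
def evalAt (A : Mat N) (p : MvPolynomial (Fin N × Fin N) ℂ) : ℂ :=
  MvPolynomial.eval (fun e => A e.1 e.2) p

/-- Zariski closed subsets of `GL N`. (Zero loci of polynomials in the entries; denominators `det`
can be cleared, as `det` is invertible on `GL N`.) -/
def IsZariskiClosed (S : Set (GL (Fin N) ℂ)) : Prop :=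
  ∃ P : Set (MvPolynomial (Fin N × Fin N) ℂ),
    S = {g : GL (Fin N) ℂ | ∀ p ∈ P, evalAt (g : Mat N) p = 0}

/-- Connectedness of a subgroup of `GL N` in the Zariski topology. -/
def IsZariskiConnected (G : Subgroup (GL (Fin N) ℂ)) : Prop :=
  ∀ A B : Set (GL (Fin N) ℂ), IsZariskiClosed A → IsZariskiClosed B →
    A ∪ B = (G : Set (GL (Fin N) ℂ)) → Disjoint A B → A = ∅ ∨ B = ∅

/-- All elements of the subgroup are unipotent matrices. -/
def IsUnipotentSubgroup (U : Subgroup (GL (Fin N) ℂ)) : Prop :=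
  ∀ u ∈ U, IsNilpotent ((u : Mat N) - 1)

/-- `G ⊆ GL N` is a connected reductive linear algebraic group: it is Zariski closed, connected,
and its unipotent radical is trivial. -/
structure IsConnectedReductive (G : Subgroup (GL (Fin N) ℂ)) : Prop where
  closed : IsZariskiClosed (G : Set (GL (Fin N) ℂ))
  connected : IsZariskiConnected G
  reductive : ∀ U : Subgroup (GL (Fin N) ℂ), U ≤ G →
    IsZariskiClosed (U : Set (GL (Fin N) ℂ)) → IsZariskiConnected U →
    (∀ g ∈ G, ∀ u ∈ U, g * u * g⁻¹ ∈ U) → IsUnipotentSubgroup U → U = ⊥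

/-- The derivation of the polynomial ring given by the left invariant vector field
`A ↦ A * X`, i.e. `f ↦ (A ↦ d/ds f (A * (1 + s X)))` at `s = 0`. -/
def leftInvDer (X : Mat N) :
    Derivation ℂ (MvPolynomial (Fin N × Fin N) ℂ) (MvPolynomial (Fin N × Fin N) ℂ) :=
  MvPolynomial.mkDerivation ℂ fun e =>
    ∑ l, MvPolynomial.C (X l e.2) * MvPolynomial.X (e.1, l)

/-- Left translation of a polynomial function: `f ↦ (A ↦ f (h * A))`. -/
def translate (h : Mat N) :
    MvPolynomial (Fin N × Fin N) ℂ →ₐ[ℂ] MvPolynomial (Fin N × Fin N) ℂ :=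
  MvPolynomial.aeval fun e => ∑ l, MvPolynomial.C (h e.1 l) * MvPolynomial.X (l, e.2)

theorem evalAt_translate (h A : Mat N) (p : MvPolynomial (Fin N × Fin N) ℂ) :
    evalAt A (translate h p) = evalAt (h * A) p := by
  induction p using MvPolynomial.induction_on with
  | C a => simp [evalAt, translate]
  | add p q hp hq => simp_all [evalAt]
  | mul_X p e hp => simp_all [evalAt, translate, Matrix.mul_apply]

theorem leftInvDer_X (X : Mat N) (e : Fin N × Fin N) :
    leftInvDer X (MvPolynomial.X e) =
      ∑ l, MvPolynomial.C (X l e.2) * MvPolynomial.X (e.1, l) := by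
  simp [leftInvDer]

theorem evalAt_mul_leftInvDer (h X A : Mat N) (p : MvPolynomial (Fin N × Fin N) ℂ) :
    evalAt A (leftInvDer X (translate h p)) = evalAt (h * A) (leftInvDer X p) := by
  induction p using MvPolynomial.induction_on with
  | C a => simp [evalAt, translate]
  | add p q hp hq => simp_all [evalAt]
  | mul_X p e hp =>
    have hX : evalAt A (leftInvDer X (translate h (MvPolynomial.X e))) =
        evalAt (h * A) (leftInvDer X (MvPolynomial.X e)) := by
      simp only [translate, MvPolynomial.aeval_X, map_sum, Derivation.leibniz, leftInvDer_X,
        MvPolynomial.derivation_C, evalAt, smul_eq_mul, map_mul, mul_zero, add_zero,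
        MvPolynomial.eval_C, MvPolynomial.eval_X, Matrix.mul_apply, Finset.mul_sum]
      rw [Finset.sum_comm]
      refine Finset.sum_congr rfl fun i _ => Finset.sum_congr rfl fun j _ => ?_
      ring
    have h1 := evalAt_translate h A p
    have h2 := evalAt_translate h A (MvPolynomial.X e)
    simp only [evalAt, map_mul, Derivation.leibniz, smul_eq_mul, map_add] at *
    rw [hp, hX, h1, h2]

theorem leftInvDer_lie (X Y : Mat N) :
    leftInvDer ⁅X, Y⁆ = ⁅leftInvDer X, leftInvDer Y⁆ := by
  refine MvPolynomial.derivation_ext fun e => ?_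
  have h : ∀ A B : Mat N, leftInvDer A (leftInvDer B (MvPolynomial.X e)) =
      ∑ l, MvPolynomial.C ((A * B) l e.2) * MvPolynomial.X (e.1, l) := by
    intro A B
    simp only [leftInvDer_X, map_sum, Derivation.leibniz, MvPolynomial.derivation_C, smul_eq_mul,
      mul_zero, add_zero, Finset.mul_sum, Matrix.mul_apply, Finset.sum_mul, map_mul]
    rw [Finset.sum_comm]
    refine Finset.sum_congr rfl fun i _ => Finset.sum_congr rfl fun j _ => ?_
    ring
  rw [Derivation.commutator_apply, h, h, leftInvDer_X, ← Finset.sum_sub_distrib]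
  refine Finset.sum_congr rfl fun l _ => ?_
  rw [LieRing.of_associative_ring_bracket, Matrix.sub_apply, map_sub, sub_mul]

theorem leftInvDer_add (X Y : Mat N) :
    leftInvDer (X + Y) = leftInvDer X + leftInvDer Y := by
  refine MvPolynomial.derivation_ext fun e => ?_
  simp [leftInvDer_X, add_mul, Finset.sum_add_distrib]

theorem leftInvDer_smul (a : ℂ) (X : Mat N) :
    leftInvDer (a • X) = a • leftInvDer X := by
  refine MvPolynomial.derivation_ext fun e => ?_
  simp [leftInvDer_X, Finset.smul_sum, MvPolynomial.smul_eq_C_mul, mul_assoc]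

/-- The Lie algebra of `G ⊆ GL N`, as a Lie subalgebra of `gl N` with the commutator bracket: the
tangent space at the identity, i.e. all `X` such that `d/ds f (1 + s X) = 0` at `s = 0` for every
polynomial `f` that vanishes on `G`. -/
def lieAlg (G : Subgroup (GL (Fin N) ℂ)) : LieSubalgebra ℂ (Mat N) where
  carrier := {X | ∀ f : MvPolynomial (Fin N × Fin N) ℂ,
    (∀ g ∈ G, evalAt (g : Mat N) f = 0) → evalAt 1 (leftInvDer X f) = 0}
  zero_mem' := by
    intro f _
    have := leftInvDer_smul (0 : ℂ) (0 : Mat N)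
    simp only [zero_smul] at this
    simp [this, evalAt]
  add_mem' := by
    intro X Y hX hY f hf
    have h1 := hX f hf
    have h2 := hY f hf
    simp only [evalAt] at h1 h2
    simp [leftInvDer_add, evalAt, h1, h2]
  smul_mem' := by
    intro a X hX f hf
    have h1 := hX f hf
    simp only [evalAt] at h1
    simp [leftInvDer_smul, evalAt, MvPolynomial.smul_eval, h1]
  lie_mem' := by
    intro X Y hX hY f hf
    have key : ∀ Z : Mat N,
        (∀ f : MvPolynomial (Fin N × Fin N) ℂ,
          (∀ g ∈ G, evalAt (g : Mat N) f = 0) → evalAt 1 (leftInvDer Z f) = 0) →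
        ∀ g ∈ G, evalAt (g : Mat N) (leftInvDer Z f) = 0 := by
      intro Z hZ g hg
      have h1 := evalAt_mul_leftInvDer (g : Mat N) Z 1 f
      rw [mul_one] at h1
      rw [← h1]
      refine hZ _ fun g' hg' => ?_
      rw [evalAt_translate]
      simpa using hf (g * g') (G.mul_mem hg hg')
    have h1 := hX _ (key Y hY)
    have h2 := hY _ (key X hX)
    simp only [evalAt] at h1 h2
    simp [leftInvDer_lie, Derivation.commutator_apply, evalAt, h1, h2]

/-! ### Jordan decomposition -/

/-- Semisimple (i.e. diagonalizable) matrices. -/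
def IsSemisimpleMat (X : Mat N) : Prop := Module.End.IsSemisimple (Matrix.toLin' X)

/-- `X = S + J` is the (additive) Jordan decomposition of `X`. -/
structure IsJordanDecomposition (X S J : Mat N) : Prop where
  semisimple : IsSemisimpleMat S
  nilpotent : IsNilpotent J
  commute : Commute S J
  eq_add : X = S + J

theorem exists_jordan (X : Mat N) : ∃ q : Mat N × Mat N, IsJordanDecomposition X q.1 q.2 := by
  obtain ⟨n, hn, s, hs, hnil, hss, h⟩ :=
    Module.End.exists_isNilpotent_isSemisimple (f := Matrix.toLin' X)
  have hc : Commute s n :=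
    Algebra.commute_of_mem_adjoin_singleton_of_commute hn
      (Algebra.commute_of_mem_adjoin_self hs).symm
  refine ⟨(LinearMap.toMatrixAlgEquiv' s, LinearMap.toMatrixAlgEquiv' n), ?_, ?_, ?_, ?_⟩
  · have h1 : Matrix.toLin' (LinearMap.toMatrixAlgEquiv' s) = s := Matrix.toLin'_toMatrix' s
    rw [IsSemisimpleMat, h1]
    exact hss
  · exact hnil.map LinearMap.toMatrixAlgEquiv'
  · exact hc.map LinearMap.toMatrixAlgEquiv'
  · have h2 : X = LinearMap.toMatrixAlgEquiv' (Matrix.toLin' X) :=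
      (LinearMap.toMatrix'_toLin' X).symm
    calc X = LinearMap.toMatrixAlgEquiv' (Matrix.toLin' X) := h2
      _ = LinearMap.toMatrixAlgEquiv' (s + n) := by rw [h, add_comm]
      _ = _ := map_add _ _ _

/-- Semisimple part in the Jordan decomposition. -/
def ssPart (X : Mat N) : Mat N := (exists_jordan X).choose.1

/-- Nilpotent part in the Jordan decomposition. -/
def nilPart (X : Mat N) : Mat N := (exists_jordan X).choose.2

theorem isJordanDecomposition_parts (X : Mat N) :
    IsJordanDecomposition X (ssPart X) (nilPart X) := (exists_jordan X).choose_spec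

/-! ### Cartan subalgebras, roots, simple systems, Levi subgroups -/

/-- `t` is a maximal toral subalgebra (a Cartan subalgebra) of the Lie algebra of `G`. -/
def IsMaximalToral (G : Subgroup (GL (Fin N) ℂ)) (t : LieSubalgebra ℂ (Mat N)) : Prop :=
  Maximal (fun s : LieSubalgebra ℂ (Mat N) => s ≤ lieAlg G ∧ ∀ X ∈ s, IsSemisimpleMat X) t

/-- The simultaneous eigenspace of `t` in the Lie algebra of `G` for the functional `α`. -/
def rootSpace (G : Subgroup (GL (Fin N) ℂ)) (t : LieSubalgebra ℂ (Mat N))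
    (α : Module.Dual ℂ t) : Submodule ℂ (Mat N) where
  carrier := {X | X ∈ lieAlg G ∧ ∀ T : t, ⁅(T : Mat N), X⁆ = α T • X}
  zero_mem' := ⟨(lieAlg G).zero_mem, by simp⟩
  add_mem' := fun hX hY =>
    ⟨(lieAlg G).add_mem hX.1 hY.1, fun T => by rw [lie_add, hX.2, hY.2, smul_add]⟩
  smul_mem' := fun a _ hX =>
    ⟨(lieAlg G).smul_mem a hX.1, fun T => by rw [lie_smul, hX.2, smul_comm]⟩

/-- The set of roots of the Lie algebra of `G` with respect to `t`. -/
def roots (G : Subgroup (GL (Fin N) ℂ)) (t : LieSubalgebra ℂ (Mat N)) :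
    Set (Module.Dual ℂ t) :=
  {α | α ≠ 0 ∧ rootSpace G t α ≠ ⊥}

/-- `Δ` is a system of simple roots: linearly independent roots such that each root is a sum of
elements of `Δ` or the negative of such a sum. -/
structure IsSimpleSystem (G : Subgroup (GL (Fin N) ℂ)) (t : LieSubalgebra ℂ (Mat N))
    (Δ : Set (Module.Dual ℂ t)) : Prop where
  subset : Δ ⊆ roots G t
  linearIndepOn : LinearIndepOn ℂ id Δ
  pos_or_neg : ∀ α ∈ roots G t, α ∈ AddSubmonoid.closure Δ ∨ -α ∈ AddSubmonoid.closure Δ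

/-- The subspace `t ⊕ ⨁ 𝔤_α`, where `α` runs over the roots in the `ℤ`-span of `Δ'`. -/
def leviAlg (G : Subgroup (GL (Fin N) ℂ)) (t : LieSubalgebra ℂ (Mat N))
    (Δ' : Set (Module.Dual ℂ t)) : Submodule ℂ (Mat N) :=
  t.toSubmodule ⊔
    ⨆ α ∈ {α | α ∈ roots G t ∧ α ∈ AddSubgroup.closure Δ'}, rootSpace G t α

/-- The analytic subgroup with Lie algebra `leviAlg G t Δ'`, i.e. the group generated by the
exponentials of its elements. -/
def leviGroup (G : Subgroup (GL (Fin N) ℂ)) (t : LieSubalgebra ℂ (Mat N))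
    (Δ' : Set (Module.Dual ℂ t)) : Subgroup (GL (Fin N) ℂ) :=
  Subgroup.closure {g | ∃ X ∈ leviAlg G t Δ', (g : Mat N) = NormedSpace.exp X}

/-- The orbit of `J` under the adjoint action (conjugation) of `L`. -/
def adOrbit (L : Subgroup (GL (Fin N) ℂ)) (J : Mat N) : Set (Mat N) :=
  {Y | ∃ g ∈ L, Y = (g : Mat N) * J * ((g⁻¹ : GL (Fin N) ℂ) : Mat N)}

/-! ### Canonical forms and their spectral types -/

/-- An unramified canonical form `(H_k / z^k + ⋯ + H_1 / z + H_res) dz / z` with coefficients in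
the Lie algebra of `G`, recorded through its coefficients: `coeff 0 = H_res`, and `coeff i = H_i`
for `1 ≤ i`. The same data stand for a canonical form at any other point `a`, with `z - a` in place
of `z`. -/
structure CanonicalForm (G : Subgroup (GL (Fin N) ℂ)) (k : ℕ) where
  coeff : Fin (k + 1) → lieAlg G
  semisimple : ∀ i, i ≠ 0 → IsSemisimpleMat (coeff i : Mat N)
  lie_eq_zero : ∀ i j, ⁅coeff i, coeff j⁆ = 0

namespace CanonicalForm

variable {G : Subgroup (GL (Fin N) ℂ)} {k : ℕ}

/-- The elements `H_k, …, H_1, H_0`, where `H_res = H_0 + J_0` is the Jordan decomposition: the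
semisimple parts of the coefficients (for `1 ≤ i` the coefficient is itself semisimple). -/
def ss (H : CanonicalForm G k) (i : Fin (k + 1)) : Mat N := ssPart (H.coeff i : Mat N)

/-- The nilpotent part `J_0` of `H_res`. -/
def nilRes (H : CanonicalForm G k) : Mat N := nilPart (H.coeff 0 : Mat N)

/-- `t` contains `H_0, H_1, …, H_k`. -/
def IsIn (H : CanonicalForm G k) (t : LieSubalgebra ℂ (Mat N)) : Prop := ∀ i, H.ss i ∈ t

/-- The number `α (H_i)`. -/
def rootVal (H : CanonicalForm G k) {t : LieSubalgebra ℂ (Mat N)} (hH : H.IsIn t)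
    (α : Module.Dual ℂ t) (i : Fin (k + 1)) : ℂ := α ⟨H.ss i, hH i⟩

/-- The set of simple roots `Π_i = {α ∈ Δ | α (H_k) = ⋯ = α (H_i) = 0}`. -/
def chain (H : CanonicalForm G k) {t : LieSubalgebra ℂ (Mat N)} (hH : H.IsIn t)
    (Δ : Set (Module.Dual ℂ t)) (i : Fin (k + 1)) : Set (Module.Dual ℂ t) :=
  {α | α ∈ Δ ∧ ∀ m, i ≤ m → H.rootVal hH α m = 0}

end CanonicalForm

/-- A sequence `Π_0, …, Π_k` of sets of simple roots, extended by `Π_i = Δ` for `k < i`. -/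
def extendChain {t : LieSubalgebra ℂ (Mat N)} {k : ℕ} (Δ : Set (Module.Dual ℂ t))
    (P : Fin (k + 1) → Set (Module.Dual ℂ t)) (i : ℕ) : Set (Module.Dual ℂ t) :=
  if h : i < k + 1 then P ⟨i, h⟩ else Δ

/-- A pair of a sequence of sets of simple roots and a set of matrices (an adjoint orbit). -/
@[ext]
structure SpectralType (N : ℕ) (t : LieSubalgebra ℂ (Mat N)) (k : ℕ) where
  chain : Fin (k + 1) → Set (Module.Dual ℂ t)
  orbit : Set (Mat N)

/-- The spectral type `(Π_k ⊇ ⋯ ⊇ Π_0; [J])`, where `[J]` is the orbit of `J` under the adjoint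
action of the Levi subgroup `L_1` that belongs to `Π_1` (to `Π_1 = Δ` if `k = 0`). -/
def spectralTypeMk (G : Subgroup (GL (Fin N) ℂ)) {t : LieSubalgebra ℂ (Mat N)} {k : ℕ}
    (Δ : Set (Module.Dual ℂ t)) (P : Fin (k + 1) → Set (Module.Dual ℂ t)) (J : Mat N) :
    SpectralType N t k where
  chain := P
  orbit := adOrbit (leviGroup G t (extendChain Δ P 1)) J

namespace CanonicalForm

variable {G : Subgroup (GL (Fin N) ℂ)} {k : ℕ}

/-- The spectral type of a canonical form with respect to the Cartan subalgebra `t` and the simple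
system `Δ`. -/
def spectralType (H : CanonicalForm G k) {t : LieSubalgebra ℂ (Mat N)} (hH : H.IsIn t)
    (Δ : Set (Module.Dual ℂ t)) : SpectralType N t k :=
  spectralTypeMk G Δ (H.chain hH Δ) H.nilRes

/-- The normalization that the Weyl group allows: `H_k` is in the fundamental domain
`{X | Re α(X) ≥ 0, and Im α(X) ≥ 0 if Re α(X) = 0, for all α ∈ Δ}`, and inductively `H_i` is in the
domain given by the same conditions for all `α ∈ Π_{i+1}`, where `Π_{k+1} = Δ`. -/
def IsNormalized (H : CanonicalForm G k) {t : LieSubalgebra ℂ (Mat N)} (hH : H.IsIn t)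
    (Δ : Set (Module.Dual ℂ t)) : Prop :=
  ∀ i : Fin (k + 1), ∀ α ∈ extendChain Δ (H.chain hH Δ) ((i : ℕ) + 1),
    0 ≤ (H.rootVal hH α i).re ∧
      ((H.rootVal hH α i).re = 0 → 0 ≤ (H.rootVal hH α i).im)

/-! ### The parameter space and the unfolding -/

/-- The value at `c` of the polynomial
`f_α^{(i)} = ∑_{j=i}^{d} α(H_j) ∏_{ν=j+1}^{d} (x_i - x_ν)`. -/
def unfoldPoly (H : CanonicalForm G k) {t : LieSubalgebra ℂ (Mat N)} (hH : H.IsIn t)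
    (α : Module.Dual ℂ t) (d i : Fin (k + 1)) (c : Fin (k + 1) → ℂ) : ℂ :=
  ∑ j ∈ Finset.Icc i d, H.rootVal hH α j * ∏ ν ∈ Finset.Ioc j d, (c i - c ν)

/-- The parameter space `𝔹_H`: all `c` with `f_α^{(i)}(c) ≠ 0` for all `α ∈ Δ \ Π_0` and
`i = 0, …, d(α)`, where `d(α)` is the largest `d` with `α ∉ Π_d`. -/
def paramSpace (H : CanonicalForm G k) {t : LieSubalgebra ℂ (Mat N)} (hH : H.IsIn t)
    (Δ : Set (Module.Dual ℂ t)) : Set (Fin (k + 1) → ℂ) :=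
  {c | ∀ α ∈ Δ \ H.chain hH Δ 0, ∀ d, IsGreatest {i | α ∉ H.chain hH Δ i} d →
    ∀ i ≤ d, H.unfoldPoly hH α d i c ≠ 0}

/-- The unfolding `H(c) = ∑_{i=0}^{k} H_i / ((z - c_0) ⋯ (z - c_i))` (with `H_res` in place of
`H_0`), an element of `𝔤 ⊗ ℂ(z)`. -/
def unfold (H : CanonicalForm G k) (c : Fin (k + 1) → ℂ) : lieAlg G ⊗[ℂ] RatFunc ℂ :=
  ∑ i, H.coeff i ⊗ₜ[ℂ] (∏ l ∈ Finset.Iic i, (RatFunc.X - RatFunc.C (c l)))⁻¹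

end CanonicalForm

/-- The element `∑_{ν=0}^{k} A_ν / (z - a)^{ν+1}` of `𝔤 ⊗ ℂ(z)`. -/
def principalPart {G : Subgroup (GL (Fin N) ℂ)} {k : ℕ} (A : Fin (k + 1) → lieAlg G) (a : ℂ) :
    lieAlg G ⊗[ℂ] RatFunc ℂ :=
  ∑ ν, A ν ⊗ₜ[ℂ] ((RatFunc.X - RatFunc.C a) ^ ((ν : ℕ) + 1))⁻¹

/-! ### Partitions of `{0, …, k}` and strata -/

/-- A partition `I_0 ⊔ ⋯ ⊔ I_r = {0, …, k}` into nonempty parts with `0 ∈ I_0`. The part `I_j` is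
given by its increasing enumeration `idx j 0 < ⋯ < idx j (len j)`. -/
structure IndexPartition (k : ℕ) where
  r : ℕ
  len : Fin (r + 1) → ℕ
  idx : ∀ j : Fin (r + 1), Fin (len j + 1) → Fin (k + 1)
  strictMono : ∀ j, StrictMono (idx j)
  bijective : Function.Bijective fun x : (Σ j : Fin (r + 1), Fin (len j + 1)) => idx x.1 x.2
  zero_mem : 0 ∈ Set.range (idx 0)

/-- The stratum of a partition: `c_i = c_{i'}` exactly if `i` and `i'` are in the same part. -/
def IndexPartition.stratum {k : ℕ} (I : IndexPartition k) : Set (Fin (k + 1) → ℂ) :=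
  {c | ∀ j ν j' ν', c (I.idx j ν) = c (I.idx j' ν') ↔ j = j'}

end Unfolding

end

/-!
On commuting matrices the semisimple and the nilpotent part are linear. The semisimple and the
nilpotent parts of the coefficients of `H(c)_j` are therefore the coefficients in the partial
fraction decompositions of `∑ H_i / ∏_{l ≤ i} (z - c_l)` and `J_0 / (z - c_0)`, so only the residue
at `c_0` has a nilpotent part, and it is `J_0`.

For a simple root `α` outside `Π_0` the function `α(H(c))`, formed with the `H_i`, is
`P / ∏_{l ≤ d(α)} (z - c_l)` with `P(c_i) = f_α^{(i)}(c)`. If these values are nonzero nothing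
cancels: the pole at `c_i` has order `#{l ≤ d(α) | c_l = c_i}`, and these pole orders determine at
which steps of the chain of `H(c)_j` the root `α` drops out.
-/

namespace Unfolding

open Finset Polynomial

open Lagrange (nodal)

section Jordan

variable {N : ℕ} {X Y S J : Mat N}

theorem IsSemisimpleMat.smul (hX : IsSemisimpleMat X) (a : ℂ) : IsSemisimpleMat (a • X) := by
  rw [IsSemisimpleMat, map_smul]
  exact Module.End.IsSemisimple_smul a hX

theorem IsSemisimpleMat.add (hX : IsSemisimpleMat X) (hY : IsSemisimpleMat Y)
    (h : Commute X Y) : IsSemisimpleMat (X + Y) := by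
  rw [IsSemisimpleMat, map_add]
  exact Module.End.IsSemisimple.add_of_commute (h.map Matrix.toLinAlgEquiv') hX hY

theorem isSemisimpleMat_sum {ι : Type*} (s : Finset ι) {X : ι → Mat N}
    (hX : ∀ i, IsSemisimpleMat (X i)) (h : ∀ i j, Commute (X i) (X j)) :
    IsSemisimpleMat (∑ i ∈ s, X i) := by
  classical
  induction s using Finset.induction_on with
  | empty => simp [IsSemisimpleMat]
  | insert i s hi ih =>
    rw [sum_insert hi]
    exact (hX i).add ih (Commute.sum_right _ _ _ fun j _ => h i j)

namespace IsJordanDecomposition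

theorem toLin'_eq (h : IsJordanDecomposition X S J) {s n : Module.End ℂ (Fin N → ℂ)}
    (hs : s.IsSemisimple) (hn : IsNilpotent n) (hc : Commute n s)
    (hX : Matrix.toLin' X = n + s) : Matrix.toLin' S = s ∧ Matrix.toLin' J = n :=
  (Module.End.isNilpotent_isSemisimple_unique (h.nilpotent.map Matrix.toLinAlgEquiv')
    h.semisimple hn hs (h.commute.symm.map Matrix.toLinAlgEquiv') hc
    (by rw [← hX, h.eq_add, map_add, add_comm]; rfl)).symm

theorem unique (h : IsJordanDecomposition X S J) {S' J' : Mat N}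
    (h' : IsJordanDecomposition X S' J') : S = S' ∧ J = J' :=
  (h.toLin'_eq h'.semisimple (h'.nilpotent.map Matrix.toLinAlgEquiv')
    (h'.commute.symm.map Matrix.toLinAlgEquiv')
    (by rw [h'.eq_add, map_add, add_comm]; rfl)).imp
    (fun hS => Matrix.toLin'.injective hS) fun hJ => Matrix.toLin'.injective hJ

theorem ssPart_eq (h : IsJordanDecomposition X S J) : ssPart X = S :=
  ((isJordanDecomposition_parts X).unique h).1

theorem nilPart_eq (h : IsJordanDecomposition X S J) : nilPart X = J :=
  ((isJordanDecomposition_parts X).unique h).2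

end IsJordanDecomposition

theorem isSemisimpleMat_iff_nilPart_eq_zero : IsSemisimpleMat X ↔ nilPart X = 0 := by
  refine ⟨fun h => ?_, fun h => ?_⟩
  · have hX : IsJordanDecomposition X X 0 :=
      ⟨h, IsNilpotent.zero, Commute.zero_right X, (add_zero X).symm⟩
    exact hX.nilPart_eq
  · have hX := isJordanDecomposition_parts X
    rw [hX.eq_add, h, add_zero]
    exact hX.semisimple

theorem toLin'_ssPart_mem_adjoin (X : Mat N) :
    Matrix.toLin' (ssPart X) ∈ Algebra.adjoin ℂ {Matrix.toLin' X} := by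
  obtain ⟨n, hn, s, hs, hnil, hss, hsum⟩ :=
    Module.End.exists_isNilpotent_isSemisimple (f := Matrix.toLin' X)
  have hc : Commute n s := Algebra.commute_of_mem_adjoin_singleton_of_commute hs
    (Algebra.commute_of_mem_adjoin_self hn).symm
  rwa [((isJordanDecomposition_parts X).toLin'_eq hss hnil hc hsum).1]

theorem commute_ssPart_right (h : Commute X Y) : Commute X (ssPart Y) := by
  have hcomm : Commute (Matrix.toLinAlgEquiv' X) (Matrix.toLinAlgEquiv' (ssPart Y)) :=
    Algebra.commute_of_mem_adjoin_singleton_of_commute (toLin'_ssPart_mem_adjoin Y)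
      (h.map Matrix.toLinAlgEquiv')
  exact hcomm.of_map Matrix.toLinAlgEquiv'.injective

theorem commute_nilPart_right (h : Commute X Y) : Commute X (nilPart Y) := by
  rw [← sub_eq_of_eq_add' (isJordanDecomposition_parts Y).eq_add]
  exact h.sub_right (commute_ssPart_right h)

theorem commute_ssPart_ssPart (h : Commute X Y) : Commute (ssPart X) (ssPart Y) :=
  commute_ssPart_right (commute_ssPart_right h.symm).symm

theorem commute_ssPart_nilPart (h : Commute X Y) : Commute (ssPart X) (nilPart Y) :=
  commute_nilPart_right (commute_ssPart_right h.symm).symm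

theorem commute_nilPart_nilPart (h : Commute X Y) : Commute (nilPart X) (nilPart Y) :=
  commute_nilPart_right (commute_nilPart_right h.symm).symm

theorem isJordanDecomposition_sum_smul {ι : Type*} (s : Finset ι) {X : ι → Mat N}
    (h : ∀ i j, Commute (X i) (X j)) (b : ι → ℂ) :
    IsJordanDecomposition (∑ i ∈ s, b i • X i) (∑ i ∈ s, b i • ssPart (X i))
      (∑ i ∈ s, b i • nilPart (X i)) where
  semisimple := isSemisimpleMat_sum s
    (fun i => (isJordanDecomposition_parts (X i)).semisimple.smul (b i))
    fun i j => ((commute_ssPart_ssPart (h i j)).smul_left _).smul_right _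
  nilpotent := Commute.isNilpotent_sum
    (fun i _ => (isJordanDecomposition_parts (X i)).nilpotent.smul (b i))
    fun i j _ _ => ((commute_nilPart_nilPart (h i j)).smul_left _).smul_right _
  commute := Commute.sum_left _ _ _ fun i _ => Commute.sum_right _ _ _ fun j _ =>
    ((commute_ssPart_nilPart (h i j)).smul_left _).smul_right _
  eq_add := by
    simp only [← sum_add_distrib, ← smul_add, ← (isJordanDecomposition_parts (X _)).eq_add]

end Jordan

section LinearAlgebra

variable {ι K M V : Type*} [Field K] [AddCommGroup M] [Module K M] [AddCommGroup V] [Module K V]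

theorem sum_tmul_injective_of_linearIndependent [Fintype ι] {v : ι → V}
    (hv : LinearIndependent K v) :
    Function.Injective fun a : ι → M => ∑ i, a i ⊗ₜ[K] v i := by
  intro a b h
  funext i
  rw [← sub_eq_zero, ← Module.forall_dual_apply_eq_zero_iff K]
  intro φ
  have hφ : ∑ j, φ (a j) • v j = ∑ j, φ (b j) • v j := by
    simpa using congrArg (TensorProduct.lid K V ∘ LinearMap.rTensor V φ) h
  rw [map_sub, sub_eq_zero]
  exact Fintype.linearIndependent_iffₛ.mp hv _ _ hφ i

theorem span_range_eq_degreeLT_card [Fintype ι] {p : ι → K[X]} (hp : LinearIndependent K p)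
    (hdeg : ∀ i, (p i).degree < Fintype.card ι) :
    Submodule.span K (Set.range p) = degreeLT K (Fintype.card ι) := by
  have := Module.Finite.equiv (degreeLTEquiv K (Fintype.card ι)).symm
  refine Submodule.eq_of_le_of_finrank_eq (Submodule.span_le.mpr ?_) ?_
  · rintro _ ⟨i, rfl⟩
    exact mem_degreeLT.mpr (hdeg i)
  · rw [finrank_span_eq_card hp, (degreeLTEquiv K (Fintype.card ι)).finrank_eq,
      Module.finrank_fin_fun]

end LinearAlgebra

section InvNodal

variable {ι K : Type*} [Field K]

/-- The rational function `1 / ∏ i ∈ s, (X - v i)`, the reciprocal of the nodal polynomial. -/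
noncomputable def invNodal (s : Finset ι) (v : ι → K) : RatFunc K :=
  (algebraMap K[X] (RatFunc K) (nodal s v))⁻¹

theorem invNodal_eq_inv_prod (s : Finset ι) (v : ι → K) :
    invNodal s v = (∏ i ∈ s, (RatFunc.X - RatFunc.C (v i)))⁻¹ := by
  simp only [invNodal, Lagrange.nodal_eq, map_prod, map_sub, RatFunc.algebraMap_X,
    RatFunc.algebraMap_C]

theorem invNodal_eq_inv_pow {s : Finset ι} {v : ι → K} {a : K} (h : ∀ i ∈ s, v i = a) :
    invNodal s v = ((RatFunc.X - RatFunc.C a) ^ #s)⁻¹ := by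
  rw [invNodal_eq_inv_prod, prod_congr rfl fun i hi => by rw [h i hi], prod_const]

theorem algebraMap_nodal_ne_zero (s : Finset ι) (v : ι → K) :
    algebraMap K[X] (RatFunc K) (nodal s v) ≠ 0 :=
  RatFunc.algebraMap_ne_zero Lagrange.nodal_ne_zero

theorem invNodal_ne_zero (s : Finset ι) (v : ι → K) : invNodal s v ≠ 0 :=
  inv_ne_zero (algebraMap_nodal_ne_zero s v)

variable [DecidableEq ι]

theorem algebraMap_nodal_sdiff_mul_invNodal {s t : Finset ι} (h : t ⊆ s) (v : ι → K) :
    algebraMap K[X] (RatFunc K) (nodal (s \ t) v) * invNodal s v = invNodal t v := by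
  have hmul : nodal s v = nodal (s \ t) v * nodal t v := (prod_sdiff h).symm
  rw [invNodal, hmul, map_mul, mul_inv, mul_inv_cancel_left₀ (algebraMap_nodal_ne_zero _ v),
    invNodal]

theorem algebraMap_sum_nodal_sdiff_mul_invNodal {κ : Type*} (u : Finset κ) {s : Finset ι}
    {t : κ → Finset ι} (h : ∀ l ∈ u, t l ⊆ s) (v : ι → K) (b : κ → K) :
    algebraMap K[X] (RatFunc K) (∑ l ∈ u, C (b l) * nodal (s \ t l) v) * invNodal s v =
      ∑ l ∈ u, b l • invNodal (t l) v := by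
  rw [map_sum, sum_mul]
  refine sum_congr rfl fun l hl => ?_
  rw [map_mul, mul_assoc, algebraMap_nodal_sdiff_mul_invNodal (h l hl), RatFunc.algebraMap_C,
    RatFunc.smul_eq_C_mul]

end InvNodal

section PartialFractions

variable {ι K : Type*} [LinearOrder ι] [LocallyFiniteOrderBot ι] [DecidableEq K]

/-- The indices `l ≤ i` with `c l = c i`. The elementary fraction of index `i` in the partial
fraction expansion with poles `c` is `invNodal (coincident c i) c`: it is `1 / (X - c i) ^ n`, where
`i` is the `n`-th index at which `c` takes the value `c i`. -/
def coincident (c : ι → K) (i : ι) : Finset ι := {l ∈ Iic i | c l = c i}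

theorem mem_coincident {c : ι → K} {i l : ι} : l ∈ coincident c i ↔ l ≤ i ∧ c l = c i := by
  simp only [coincident, mem_filter, mem_Iic]

theorem self_mem_coincident (c : ι → K) (i : ι) : i ∈ coincident c i :=
  mem_coincident.mpr ⟨le_rfl, rfl⟩

theorem coincident_subset_Iic {i d : ι} (h : i ≤ d) (c : ι → K) : coincident c i ⊆ Iic d :=
  fun _ hl => mem_Iic.mpr ((mem_coincident.mp hl).1.trans h)

variable [Field K]

theorem eval_nodal_sdiff_coincident_ne_zero {c : ι → K} {i d : ι}
    (hmax : ∀ l ≤ d, c l = c i → l ≤ i) :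
    (nodal (Iic d \ coincident c i) c).eval (c i) ≠ 0 := by
  rw [Lagrange.eval_nodal, prod_ne_zero_iff]
  intro l hl
  rw [mem_sdiff, mem_Iic, mem_coincident] at hl
  exact sub_ne_zero.mpr fun h => hl.2 ⟨hmax l hl.1 h.symm, h.symm⟩

theorem eval_sum_nodal_sdiff_coincident {c : ι → K} {i d : ι} {u : Finset ι} (hu : u ⊆ Iic d)
    (hi : i ∈ u) (hmax : ∀ l ≤ d, c l = c i → l ≤ i) (b : ι → K) :
    (∑ l ∈ u, C (b l) * nodal (Iic d \ coincident c l) c).eval (c i) =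
      b i * (nodal (Iic d \ coincident c i) c).eval (c i) := by
  simp only [eval_finsetSum, eval_C_mul]
  refine sum_eq_single_of_mem i hi fun l hl hli => ?_
  have hil : i ∉ coincident c l := fun h => hli <|
    (hmax l (mem_Iic.mp (hu hl)) (mem_coincident.mp h).2.symm).antisymm (mem_coincident.mp h).1
  rw [Lagrange.eval_nodal_at_node (mem_sdiff.mpr ⟨hu hi, hil⟩), mul_zero]

theorem linearIndependent_invNodal_coincident (c : ι → K) :
    LinearIndependent K fun i => invNodal (coincident c i) c := by
  -- Let `d` be the largest index in a vanishing combination. Over the common denominator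
  -- `nodal (Iic d) c` all numerators but that of `d` vanish at `c d`.
  refine linearIndependent_iff'.mpr fun s b hb => ?_
  by_contra! hne
  set u := {i ∈ s | b i ≠ 0}
  obtain ⟨i, his, hi⟩ := hne
  have hune : u.Nonempty := ⟨i, mem_filter.mpr ⟨his, hi⟩⟩
  set d := u.max' hune
  have hdu : d ∈ u := u.max'_mem hune
  have hud : u ⊆ Iic d := fun l hl => mem_Iic.mpr (u.le_max' l hl)
  have hnum : ∑ l ∈ u, C (b l) * nodal (Iic d \ coincident c l) c = 0 := by
    have h := algebraMap_sum_nodal_sdiff_mul_invNodal u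
      (fun l hl => coincident_subset_Iic (mem_Iic.mp (hud hl)) c) c b
    have hsum : ∑ l ∈ u, b l • invNodal (coincident c l) c = 0 := by
      rw [← hb]
      exact sum_filter_of_ne fun l _ hl h0 => hl (by rw [h0, zero_smul])
    rw [hsum] at h
    exact (map_eq_zero_iff _ (RatFunc.algebraMap_injective K)).mp
      ((mul_eq_zero_iff_right (invNodal_ne_zero _ _)).mp h)
  have heval := eval_sum_nodal_sdiff_coincident (c := c) hud hdu (fun l hl _ => hl) b
  rw [hnum, eval_zero] at heval
  exact mul_ne_zero (mem_filter.mp hdu).2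
    (eval_nodal_sdiff_coincident_ne_zero fun l hl _ => hl) heval.symm

theorem invNodal_Iic_mem_span (c : ι → K) (m : ι) :
    invNodal (Iic m) c ∈
      Submodule.span K ((fun i => invNodal (coincident c i) c) '' Set.Iic m) := by
  -- The elementary fractions of index at most `m` have linearly independent numerators over
  -- `nodal (Iic m) c`, and their number is the dimension of the space of polynomials of smaller
  -- degree than `nodal (Iic m) c`, so `1` is in their span.
  let w : K[X] →ₗ[K] RatFunc K :=
    LinearMap.mulRight K (invNodal (Iic m) c) ∘ₗ
      (Algebra.linearMap K[X] (RatFunc K)).restrictScalars K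
  let p : Iic m → K[X] := fun i => nodal (Iic m \ coincident c i) c
  have hwp (i : Iic m) : w (p i) = invNodal (coincident c i) c :=
    algebraMap_nodal_sdiff_mul_invNodal (coincident_subset_Iic (mem_Iic.mp i.2) c) c
  have hp : LinearIndependent K p := by
    refine LinearIndependent.of_comp w ?_
    simpa only [Function.comp_def, hwp] using
      (linearIndependent_invNodal_coincident c).comp _ Subtype.val_injective
  have hdeg (i : Iic m) : (p i).degree < Fintype.card (Iic m) := by
    rw [Lagrange.degree_nodal, Fintype.card_coe, Nat.cast_lt]
    exact card_lt_card (sdiff_ssubset (coincident_subset_Iic (mem_Iic.mp i.2) c)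
      ⟨_, self_mem_coincident c i⟩)
  have hone : (1 : K[X]) ∈ Submodule.span K (Set.range p) := by
    rw [span_range_eq_degreeLT_card hp hdeg, mem_degreeLT, degree_one]
    exact_mod_cast Fintype.card_pos_iff.mpr ⟨(⟨m, mem_Iic.mpr le_rfl⟩ : Iic m)⟩
  have hw := Submodule.apply_mem_span_image_of_mem_span w hone
  rw [← Set.range_comp] at hw
  refine Submodule.span_mono ?_ (by simpa [w] using hw)
  rintro _ ⟨i, rfl⟩
  exact ⟨i, mem_Iic.mp i.2, (hwp i).symm⟩

/-- The coefficients of the partial fraction expansion of `∏ l ≤ m, 1 / (X - c l)`: the entry at `i`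
belongs to the elementary fraction `invNodal (coincident c i) c`. -/
noncomputable def nodalCoeff (c : ι → K) (m : ι) : ι →₀ K :=
  (linearIndependent_invNodal_coincident c).repr
    ⟨invNodal (Iic m) c, Submodule.span_mono (Set.image_subset_range _ _)
      (invNodal_Iic_mem_span c m)⟩

theorem linearCombination_nodalCoeff (c : ι → K) (m : ι) :
    Finsupp.linearCombination K (fun i => invNodal (coincident c i) c) (nodalCoeff c m) =
      invNodal (Iic m) c :=
  (linearIndependent_invNodal_coincident c).linearCombination_repr _

theorem nodalCoeff_eq_zero_of_lt (c : ι → K) {m i : ι} (h : m < i) : nodalCoeff c m i = 0 := by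
  obtain ⟨b, hb, hsum⟩ :=
    (Finsupp.mem_span_image_iff_linearCombination K).mp (invNodal_Iic_mem_span c m)
  rw [nodalCoeff, (linearIndependent_invNodal_coincident c).repr_eq hsum]
  exact Finsupp.notMem_support_iff.mp fun hi => h.not_ge (hb hi)

theorem nodalCoeff_bot [OrderBot ι] (c : ι → K) : nodalCoeff c ⊥ = Finsupp.single ⊥ 1 := by
  refine LinearIndependent.repr_eq_single _ _ _ ?_
  have : coincident c ⊥ = Iic ⊥ := by
    ext l
    simp +contextual [mem_coincident]
  rw [this]

variable [Fintype ι] {M M' P : Type*} [AddCommGroup M] [Module K M] [AddCommGroup M'] [Module K M']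
  [AddCommGroup P] [Module K P]

/-- The coefficient of `invNodal (coincident c i) c` in the partial fraction expansion of
`∑ m, a m / ∏ l ≤ m, (X - c l)`. -/
noncomputable def partialFractionCoeff (c : ι → K) (a : ι → M) (i : ι) : M :=
  ∑ m, nodalCoeff c m i • a m

theorem map_partialFractionCoeff (φ : M →ₗ[K] M') (c : ι → K) (a : ι → M) (i : ι) :
    φ (partialFractionCoeff c a i) = partialFractionCoeff c (fun m => φ (a m)) i := by
  simp only [partialFractionCoeff, map_sum, map_smul]

theorem partialFractionCoeff_eq_zero {c : ι → K} {a : ι → M} {i : ι} (h : ∀ m, i ≤ m → a m = 0) :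
    partialFractionCoeff c a i = 0 := by
  refine sum_eq_zero fun m _ => ?_
  obtain hm | hm := le_or_gt i m
  · rw [h m hm, smul_zero]
  · rw [nodalCoeff_eq_zero_of_lt c hm, zero_smul]

theorem partialFractionCoeff_single_bot [OrderBot ι] (c : ι → K) (x : M) :
    partialFractionCoeff c (Pi.single ⊥ x) = Pi.single ⊥ x := by
  funext i
  rw [partialFractionCoeff,
    Fintype.sum_eq_single ⊥ fun m hm => by rw [Pi.single_eq_of_ne hm, smul_zero], nodalCoeff_bot,
    Pi.single_eq_same, Finsupp.single_apply, Pi.single_apply, ite_smul, one_smul, zero_smul]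
  simp only [eq_comm]

theorem sum_apply_invNodal_Iic (B : M →ₗ[K] RatFunc K →ₗ[K] P) (c : ι → K) (a : ι → M) :
    ∑ m, B (a m) (invNodal (Iic m) c) =
      ∑ i, B (partialFractionCoeff c a i) (invNodal (coincident c i) c) := by
  have hexp (m : ι) : invNodal (Iic m) c =
      ∑ i, nodalCoeff c m i • invNodal (coincident c i) c := by
    rw [← linearCombination_nodalCoeff, Finsupp.linearCombination_apply]
    exact Finsupp.sum_fintype _ _ fun i => zero_smul K _
  simp only [hexp, partialFractionCoeff, map_sum, LinearMap.sum_apply, map_smul,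
    LinearMap.smul_apply]
  exact sum_comm

/-- The numerator of `∑ m ≤ d, a m / ∏ l ≤ m, (X - c l)` over the denominator
`∏ l ≤ d, (X - c l)`. -/
noncomputable def newtonNumerator (c a : ι → K) (d : ι) : K[X] :=
  ∑ m ∈ Iic d, C (a m) * nodal (Iic d \ Iic m) c

theorem newtonNumerator_eq_sum_partialFractionCoeff (c : ι → K) {a : ι → K} {d : ι}
    (ha : ∀ m, d < m → a m = 0) :
    newtonNumerator c a d =
      ∑ l ∈ Iic d, C (partialFractionCoeff c a l) * nodal (Iic d \ coincident c l) c := by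
  have htail (b : ι → K) (v : ι → RatFunc K) (hb : ∀ m, d < m → b m = 0) :
      ∑ m ∈ Iic d, b m • v m = ∑ m, b m • v m :=
    sum_subset (subset_univ _) fun m _ hm => by
      rw [hb m (not_le.mp fun h => hm (mem_Iic.mpr h)), zero_smul]
  have hpf (m : ι) (hm : d < m) : partialFractionCoeff c a m = 0 :=
    partialFractionCoeff_eq_zero fun l hl => ha l (hm.trans_le hl)
  refine RatFunc.algebraMap_injective K (mul_right_cancel₀ (invNodal_ne_zero (Iic d) c) ?_)
  rw [newtonNumerator,
    algebraMap_sum_nodal_sdiff_mul_invNodal _ (fun m hm => Iic_subset_Iic.mpr (mem_Iic.mp hm)),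
    algebraMap_sum_nodal_sdiff_mul_invNodal _ (fun m hm => coincident_subset_Iic (mem_Iic.mp hm) c),
    htail _ _ ha, htail _ _ hpf]
  exact sum_apply_invNodal_Iic (LinearMap.lsmul K (RatFunc K)) c a

theorem exists_partialFractionCoeff_ne_zero {c a : ι → K} {i d : ι} (hid : i ≤ d)
    (ha : ∀ m, d < m → a m = 0) (hnum : (newtonNumerator c a d).eval (c i) ≠ 0) :
    ∃ l, i ≤ l ∧ c l = c i ∧ partialFractionCoeff c a l ≠ 0 := by
  set u := {l ∈ Iic d | c l = c i}
  have hiu : i ∈ u := mem_filter.mpr ⟨mem_Iic.mpr hid, rfl⟩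
  have hlu : u.max' ⟨i, hiu⟩ ∈ u := u.max'_mem _
  set l := u.max' ⟨i, hiu⟩
  obtain ⟨hld, hl⟩ := mem_filter.mp hlu
  refine ⟨l, u.le_max' i hiu, hl, fun h0 => hnum ?_⟩
  have hmax : ∀ m ≤ d, c m = c l → m ≤ l := fun m hm hml =>
    u.le_max' m (mem_filter.mpr ⟨mem_Iic.mpr hm, hml.trans hl⟩)
  rw [newtonNumerator_eq_sum_partialFractionCoeff c ha, ← hl,
    eval_sum_nodal_sdiff_coincident subset_rfl hld hmax, h0, zero_mul]

end PartialFractions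

namespace IndexPartition

variable {k : ℕ} (I : IndexPartition k)

/-- The enumeration of `{0, …, k}` along the parts of the partition. -/
noncomputable def equiv : (Σ j : Fin (I.r + 1), Fin (I.len j + 1)) ≃ Fin (k + 1) :=
  Equiv.ofBijective _ I.bijective

theorem idx_zero_zero : I.idx 0 0 = 0 := by
  obtain ⟨ν, hν⟩ := I.zero_mem
  exact Fin.le_zero_iff.mp (hν ▸ (I.strictMono 0).monotone (Fin.zero_le ν))

theorem idx_eq_zero_iff {j : Fin (I.r + 1)} {ν : Fin (I.len j + 1)} :
    I.idx j ν = 0 ↔ j = 0 ∧ ν = 0 := by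
  constructor
  · intro h
    have hx : (⟨j, ν⟩ : Σ j : Fin (I.r + 1), Fin (I.len j + 1)) = ⟨0, 0⟩ :=
      I.bijective.injective (h.trans I.idx_zero_zero.symm)
    obtain rfl : j = 0 := congrArg Sigma.fst hx
    exact ⟨rfl, (I.strictMono 0).injective (h.trans I.idx_zero_zero.symm)⟩
  · rintro ⟨rfl, rfl⟩
    exact I.idx_zero_zero

variable {I} {c : Fin (k + 1) → ℂ}

theorem exists_idx_eq_of_mem_stratum (hc : c ∈ I.stratum) {j : Fin (I.r + 1)}
    {ν : Fin (I.len j + 1)} {l : Fin (k + 1)} (h : c l = c (I.idx j ν)) : ∃ μ, I.idx j μ = l := by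
  obtain ⟨⟨j', μ⟩, rfl⟩ := I.bijective.surjective l
  obtain rfl := (hc j' μ j ν).mp h
  exact ⟨μ, rfl⟩

theorem coincident_idx (hc : c ∈ I.stratum) (j : Fin (I.r + 1)) (ν : Fin (I.len j + 1)) :
    coincident c (I.idx j ν) = (Iic ν).map ⟨I.idx j, (I.strictMono j).injective⟩ := by
  ext l
  simp only [mem_coincident, mem_map, mem_Iic, Function.Embedding.coeFn_mk]
  constructor
  · rintro ⟨hl, hcl⟩
    obtain ⟨μ, rfl⟩ := exists_idx_eq_of_mem_stratum hc hcl
    exact ⟨μ, (I.strictMono j).le_iff_le.mp hl, rfl⟩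
  · rintro ⟨μ, hμ, rfl⟩
    exact ⟨(I.strictMono j).monotone hμ, (hc j μ j ν).mpr rfl⟩

theorem invNodal_coincident_idx (hc : c ∈ I.stratum) (j : Fin (I.r + 1))
    (ν : Fin (I.len j + 1)) :
    invNodal (coincident c (I.idx j ν)) c =
      ((RatFunc.X - RatFunc.C (c (I.idx j 0))) ^ ((ν : ℕ) + 1))⁻¹ := by
  have hcard : #(coincident c (I.idx j ν)) = (ν : ℕ) + 1 := by
    rw [coincident_idx hc, card_map, Fin.card_Iic]
  rw [← hcard]
  exact invNodal_eq_inv_pow fun l hl =>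
    (mem_coincident.mp hl).2.trans ((hc j ν j 0).mpr rfl)

variable {N : ℕ} {G : Subgroup (GL (Fin N) ℂ)}

theorem sum_principalPart (hc : c ∈ I.stratum)
    (A : ∀ j : Fin (I.r + 1), Fin (I.len j + 1) → lieAlg G) :
    ∑ j, principalPart (A j) (c (I.idx j 0)) =
      ∑ x : Σ j : Fin (I.r + 1), Fin (I.len j + 1),
        A x.1 x.2 ⊗ₜ[ℂ] invNodal (coincident c (I.equiv x)) c := by
  rw [Fintype.sum_sigma]
  refine sum_congr rfl fun j _ => sum_congr rfl fun ν _ => ?_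
  rw [← invNodal_coincident_idx hc]
  rfl

theorem sum_principalPart_injective (hc : c ∈ I.stratum) :
    Function.Injective fun A : ∀ j : Fin (I.r + 1), Fin (I.len j + 1) → lieAlg G =>
      ∑ j, principalPart (A j) (c (I.idx j 0)) := by
  intro A B h
  simp only [sum_principalPart hc] at h
  have hAB := sum_tmul_injective_of_linearIndependent (M := lieAlg G)
    ((linearIndependent_invNodal_coincident c).comp _ I.equiv.injective)
    (a₁ := fun x => A x.1 x.2) (a₂ := fun x => B x.1 x.2) h
  exact funext fun j => funext fun ν => congrFun hAB ⟨j, ν⟩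

end IndexPartition

namespace CanonicalForm

variable {N k : ℕ} {G : Subgroup (GL (Fin N) ℂ)} (H : CanonicalForm G k) (c : Fin (k + 1) → ℂ)

theorem commute_coeff (i j : Fin (k + 1)) : Commute (H.coeff i : Mat N) (H.coeff j) :=
  commute_iff_lie_eq.mpr (congrArg Subtype.val (H.lie_eq_zero i j))

theorem nilPart_coeff :
    (fun i => nilPart (H.coeff i : Mat N)) = Pi.single 0 H.nilRes := by
  funext i
  obtain rfl | hi := eq_or_ne i 0
  · rw [Pi.single_eq_same, nilRes]
  · rw [Pi.single_eq_of_ne hi, isSemisimpleMat_iff_nilPart_eq_zero.mp (H.semisimple i hi)]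

theorem isJordanDecomposition_partialFractionCoeff (i : Fin (k + 1)) :
    IsJordanDecomposition ((partialFractionCoeff c H.coeff i : lieAlg G) : Mat N)
      (partialFractionCoeff c H.ss i) ((Pi.single 0 H.nilRes : Fin (k + 1) → Mat N) i) := by
  have hcoe : ((partialFractionCoeff c H.coeff i : lieAlg G) : Mat N) =
      partialFractionCoeff c (fun m => (H.coeff m : Mat N)) i :=
    map_partialFractionCoeff (lieAlg G).toSubmodule.subtype c H.coeff i
  have hnil : (Pi.single 0 H.nilRes : Fin (k + 1) → Mat N) =
      partialFractionCoeff c fun m => nilPart (H.coeff m : Mat N) := by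
    rw [nilPart_coeff]
    exact (partialFractionCoeff_single_bot c H.nilRes).symm
  rw [hcoe, hnil]
  exact isJordanDecomposition_sum_smul univ H.commute_coeff fun m => nodalCoeff c m i

theorem lie_partialFractionCoeff (i j : Fin (k + 1)) :
    ⁅partialFractionCoeff c H.coeff i, partialFractionCoeff c H.coeff j⁆ = 0 := by
  simp only [partialFractionCoeff, lie_sum, sum_lie, smul_lie, lie_smul, H.lie_eq_zero, smul_zero,
    sum_const_zero]

variable (I : IndexPartition k)

/-- The component `H(c)_j` of the unfolding at the point `c (I.idx j 0)`. Its coefficients are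
defined for all `c`; they have this meaning only if `c` lies in the stratum of `I`. -/
noncomputable def component (j : Fin (I.r + 1)) : CanonicalForm G (I.len j) where
  coeff ν := partialFractionCoeff c H.coeff (I.idx j ν)
  semisimple ν hν := by
    rw [isSemisimpleMat_iff_nilPart_eq_zero,
      (H.isJordanDecomposition_partialFractionCoeff c _).nilPart_eq]
    exact Pi.single_eq_of_ne (fun h => hν (I.idx_eq_zero_iff.mp h).2) _
  lie_eq_zero _ _ := H.lie_partialFractionCoeff c _ _

variable (j : Fin (I.r + 1))

theorem component_ss (ν : Fin (I.len j + 1)) :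
    (H.component c I j).ss ν = partialFractionCoeff c H.ss (I.idx j ν) :=
  (H.isJordanDecomposition_partialFractionCoeff c _).ssPart_eq

theorem component_nilRes : (H.component c I j).nilRes = if j = 0 then H.nilRes else 0 := by
  refine (H.isJordanDecomposition_partialFractionCoeff c _).nilPart_eq.trans ?_
  simp only [Pi.single_apply, I.idx_eq_zero_iff, and_true]

variable {H c I j}

theorem unfold_eq_sum_principalPart (hc : c ∈ I.stratum) :
    H.unfold c = ∑ j, principalPart (H.component c I j).coeff (c (I.idx j 0)) := by
  rw [IndexPartition.sum_principalPart hc, unfold]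
  simp only [← invNodal_eq_inv_prod]
  exact (sum_apply_invNodal_Iic (TensorProduct.mk ℂ _ _) c H.coeff).trans (I.equiv.sum_comp _).symm

variable {t : LieSubalgebra ℂ (Mat N)} (hH : H.IsIn t) {Δ : Set (Module.Dual ℂ t)}
  {α : Module.Dual ℂ t}

theorem coe_partialFractionCoeff_ss (i : Fin (k + 1)) :
    ((partialFractionCoeff c (fun m => ⟨H.ss m, hH m⟩) i : t) : Mat N) =
      partialFractionCoeff c H.ss i :=
  map_partialFractionCoeff t.toSubmodule.subtype c _ i

include hH in
theorem component_isIn : (H.component c I j).IsIn t := fun ν => by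
  rw [component_ss, ← coe_partialFractionCoeff_ss hH]
  exact Subtype.prop _

theorem component_rootVal (ν : Fin (I.len j + 1)) :
    (H.component c I j).rootVal (component_isIn hH) α ν =
      partialFractionCoeff c (H.rootVal hH α) (I.idx j ν) := by
  refine Eq.trans (congrArg α (Subtype.ext ?_)) (map_partialFractionCoeff α c _ _)
  exact (H.component_ss c I j ν).trans (coe_partialFractionCoeff_ss hH _).symm

theorem unfoldPoly_eq_eval_newtonNumerator {d i : Fin (k + 1)} (hid : i ≤ d) :
    H.unfoldPoly hH α d i c = (newtonNumerator c (H.rootVal hH α) d).eval (c i) := by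
  have hsdiff (m : Fin (k + 1)) : Iic d \ Iic m = Ioc m d := by
    ext l
    simp only [mem_sdiff, mem_Iic, mem_Ioc, not_le, and_comm]
  simp only [newtonNumerator, hsdiff, eval_finsetSum, eval_C_mul, Lagrange.eval_nodal, unfoldPoly]
  refine sum_subset (fun m hm => mem_Iic.mpr (mem_Icc.mp hm).2) fun m hmd hm => ?_
  have him : i ∈ Ioc m d :=
    mem_Ioc.mpr ⟨not_le.mp fun h => hm (mem_Icc.mpr ⟨h, mem_Iic.mp hmd⟩), hid⟩
  rw [prod_eq_zero him (sub_self _), mul_zero]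

theorem component_chain (hcB : c ∈ H.paramSpace hH Δ) (hcI : c ∈ I.stratum)
    (ν : Fin (I.len j + 1)) :
    (H.component c I j).chain (component_isIn hH) Δ ν = H.chain hH Δ (I.idx j ν) := by
  ext α
  refine and_congr_right fun hα => ⟨fun h => ?_, fun h μ hμ => ?_⟩
  · by_contra hne
    have hi : α ∉ H.chain hH Δ (I.idx j ν) := fun hi => hne hi.2
    obtain ⟨d, hd⟩ : ∃ d, IsGreatest {m | α ∉ H.chain hH Δ m} d :=
      (Set.toFinite _).bddAbove.exists_isGreatest_of_nonempty ⟨_, hi⟩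
    have hid : I.idx j ν ≤ d := hd.2 hi
    have htail (m : Fin (k + 1)) (hm : d < m) : H.rootVal hH α m = 0 :=
      (not_not.mp fun hmem => hm.not_ge (hd.2 hmem) : α ∈ H.chain hH Δ m).2 m le_rfl
    have hpoly : H.unfoldPoly hH α d (I.idx j ν) c ≠ 0 :=
      hcB α ⟨hα, fun h0 => hne fun m _ => h0.2 m (Fin.zero_le m)⟩ d hd _ hid
    rw [unfoldPoly_eq_eval_newtonNumerator hH hid] at hpoly
    obtain ⟨l, hil, hcl, hl⟩ := exists_partialFractionCoeff_ne_zero hid htail hpoly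
    obtain ⟨μ, rfl⟩ := IndexPartition.exists_idx_eq_of_mem_stratum hcI hcl
    exact hl ((component_rootVal hH μ).symm.trans (h μ ((I.strictMono j).le_iff_le.mp hil)))
  · rw [component_rootVal hH]
    exact partialFractionCoeff_eq_zero fun m hm =>
      h m (((I.strictMono j).monotone hμ).trans hm)

end CanonicalForm

end Unfolding

theorem corollary5_general {N : ℕ} (G : Subgroup (GL (Fin N) ℂ)) {k : ℕ}
    (H : Unfolding.CanonicalForm G k) (t : LieSubalgebra ℂ (Unfolding.Mat N)) (hH : H.IsIn t)
    (Δ : Set (Module.Dual ℂ t)) (I : Unfolding.IndexPartition k) (c : Fin (k + 1) → ℂ)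
    (hcB : c ∈ H.paramSpace hH Δ) (hcI : c ∈ I.stratum) :
    ∃ K : ∀ j : Fin (I.r + 1), Unfolding.CanonicalForm G (I.len j),
      H.unfold c = ∑ j, Unfolding.principalPart (K j).coeff (c (I.idx j 0)) ∧
      (∀ A : ∀ j : Fin (I.r + 1), Fin (I.len j + 1) → Unfolding.lieAlg G,
        H.unfold c = ∑ j, Unfolding.principalPart (A j) (c (I.idx j 0)) →
          ∀ j, A j = (K j).coeff) ∧
      ∀ j, ∃ hK : (K j).IsIn t,
        (K j).spectralType hK Δ =
          if j = 0 then
            Unfolding.spectralTypeMk G Δ (fun ν => H.chain hH Δ (I.idx j ν)) H.nilRes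
          else
            Unfolding.spectralTypeMk G Δ (fun ν => H.chain hH Δ (I.idx j ν)) 0 := by
  have hdecomp := H.unfold_eq_sum_principalPart hcI
  refine ⟨H.component c I, hdecomp, fun A hA => ?_, fun j => ⟨H.component_isIn hH, ?_⟩⟩
  · exact congrFun (I.sum_principalPart_injective hcI (hA.symm.trans hdecomp))
  · have hchain := funext (H.component_chain (j := j) hH hcB hcI)
    rw [Unfolding.CanonicalForm.spectralType, hchain, H.component_nilRes]
    split_ifs <;> rfl

theorem corollary5 {N : ℕ} (G : Subgroup (GL (Fin N) ℂ)) (hG : Unfolding.IsConnectedReductive G)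
    {k : ℕ} (H : Unfolding.CanonicalForm G k)
    (t : LieSubalgebra ℂ (Unfolding.Mat N)) (ht : Unfolding.IsMaximalToral G t) (hH : H.IsIn t)
    (Δ : Set (Module.Dual ℂ t)) (hΔ : Unfolding.IsSimpleSystem G t Δ)
    (hnorm : H.IsNormalized hH Δ)
    (I : Unfolding.IndexPartition k) (c : Fin (k + 1) → ℂ)
    (hcB : c ∈ H.paramSpace hH Δ) (hcI : c ∈ I.stratum) :
    -- the components `H(c)_j`, which are canonical forms at the points `c_{i_[j,0]}`
    ∃ K : ∀ j : Fin (I.r + 1), Unfolding.CanonicalForm G (I.len j),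
      -- the partial fraction decomposition of `H(c)`
      H.unfold c = ∑ j, Unfolding.principalPart (K j).coeff (c (I.idx j 0)) ∧
      -- its coefficients are unique
      (∀ A : ∀ j : Fin (I.r + 1), Fin (I.len j + 1) → Unfolding.lieAlg G,
        H.unfold c = ∑ j, Unfolding.principalPart (A j) (c (I.idx j 0)) →
          ∀ j, A j = (K j).coeff) ∧
      -- the spectral types of the components
      ∀ j, ∃ hK : (K j).IsIn t,
        (K j).spectralType hK Δ =
          if j = 0 then
            Unfolding.spectralTypeMk G Δ (fun ν => H.chain hH Δ (I.idx j ν)) H.nilRes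
          else
            Unfolding.spectralTypeMk G Δ (fun ν => H.chain hH Δ (I.idx j ν)) 0 :=
  corollary5_general G H t hH Δ I c hcB hcI
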